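/- Consider a radix-2 floating-point (FP) system of precision $p$ with extremal exponents $e_{\min}, e_{\max}$: the FP numbers are the reals $M\cdot 2^{e-p+1}$ with integers $|M|\le 2^p-1$ and $e_{\min}\le e\le e_{\max}$. Let $\Omega=(2^p-1)2^{e_{\max}-p+1}$ be the largest of them, let $\mathrm{RN}$ be a rounding to nearest (with any tie-breaking rule), and let $u=2^{-p}$. Borges' corrected fused algorithm takes two FP numbers $x,y$, exchanges them if $|x|<|y|$, and computes $$(s_x^h,s_x^\ell)=\mathrm{Fast2Mult}(x,x),\quad (s_y^h,s_y^\ell)=\mathrm{Fast2Mult}(y,y),\quad (\sigma_h,\sigma_\ell)=\mathrm{Fast2Sum}(s_x^h,s_y^h),$$ $$s=\mathrm{RN}(\sqrt{\sigma_h}),\quad \delta_s=\mathrm{RN}(\sigma_h-s^2),\quad \tau_1=\mathrm{RN}(s_x^\ell+s_y^\ell),\quad \tau_2=\mathrm{RN}(\delta_s+\sigma_\ell),$$ $$\tau=\mathrm{RN}(\tau_1+\tau_2),\quad c=\mathrm{RN}(\tau/s),\quad \rho=\mathrm{RN}(c/2+s),$$ and returns $\rho$. Here $\mathrm{Fast2Mult}(a,b)=(h,\mathrm{RN}(ab-h))$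 with $h=\mathrm{RN}(ab)$, and $\mathrm{Fast2Sum}(a,b)=(h,\mathrm{RN}(b-z))$ with $h=\mathrm{RN}(a+b)$ and $z=\mathrm{RN}(h-a)$. Let $p\ge 4$. There is a real number $\kappa$, depending only on $p$, such that $$\kappa\le\begin{cases} 21.4,& u \leq 2^{-4},\\ 6.1,& u \leq 2^{-5},\\ 2.5,& u \leq 2^{-6},\\ 1.2,& u \leq 2^{-7},\\ 0.6,& u \leq 2^{-8},\\ 7\cdot10^{-2},& u \leq 2^{-11},\\ 8\cdot10^{-6},& u \leq 2^{-24},\\ 2\cdot10^{-14},& u \leq 2^{-53},\\ 2\cdot10^{-32},& u \leq 2^{-113}, \end{cases}$$ (each line holding whenever its condition on $u$ does), and such that for all $e_{\min},e_{\max}$, every rounding to nearest $\mathrm{RN}$, and all FP numbers $x,y$, not both zero, for which no operation of the algorithm overflows or underflows, $$\left|\frac{\rho-\sqrt{x^2+y^2}}{\sqrt{x^2+y^2}}\right|\le u+(7+\kappa)u^2 .$$ Here the rounding of a real $t$ is said not to overflow if $|t|<\Omega+2^{e_{\max}-p}$ (in particular if $|t|\le\Omega$), and not to underflow if $|t|\ge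 2^{e_{\min}}$ or $t$ is itself an FP number. -/

import Mathlib

noncomputable section

namespace HypotFP

/-- `x` is a radix-2 floating-point number of precision `p` with extremal exponents `emin`, `emax`
(subnormal numbers and zero included). -/
def IsFP (p : ℕ) (emin emax : ℤ) (x : ℝ) : Prop :=
  ∃ M e : ℤ, |M| ≤ 2 ^ p - 1 ∧ emin ≤ e ∧ e ≤ emax ∧ x = (M : ℝ) * (2 : ℝ) ^ (e - (p : ℤ) + 1)

/-- The unit round-off `u = 2 ^ (-p)`. -/
def unitRoundoff (p : ℕ) : ℝ := (2 : ℝ) ^ (-(p : ℤ))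

/-- The largest finite floating-point number. -/
def largestFP (p : ℕ) (emax : ℤ) : ℝ := (2 ^ p - 1) * (2 : ℝ) ^ (emax - (p : ℤ) + 1)

/-- Rounding `t` to nearest does not overflow: `|t|` exceeds the largest finite number by less than
half a unit in the last place. In particular this holds whenever `|t| ≤ largestFP p emax`. -/
def NoOverflow (p : ℕ) (emax : ℤ) (t : ℝ) : Prop :=
  |t| < largestFP p emax + (2 : ℝ) ^ (emax - (p : ℤ))

/-- Rounding `t` does not underflow: `|t|` is not below the normal range, unless `t` is itself a
floating-point number (for instance `0`), so that it is returned exactly. -/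
def NoUnderflow (p : ℕ) (emin emax : ℤ) (t : ℝ) : Prop :=
  (2 : ℝ) ^ emin ≤ |t| ∨ IsFP p emin emax t

/-- `RN` is a round-to-nearest function, with an arbitrary tie-breaking rule. Nothing is required
of `RN t` when the rounding of `t` overflows. -/
def IsRoundToNearest (p : ℕ) (emin emax : ℤ) (RN : ℝ → ℝ) : Prop :=
  ∀ t, NoOverflow p emax t →
    IsFP p emin emax (RN t) ∧ ∀ f, IsFP p emin emax f → |t - RN t| ≤ |t - f|

/-- Fast2Mult: the rounded product, and the remainder, computed by a fused multiply-add. -/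
def fast2Mult (RN : ℝ → ℝ) (a b : ℝ) : ℝ × ℝ :=
  (RN (a * b), RN (a * b - RN (a * b)))

/-- The exact values that are rounded in `fast2Mult RN a b`. -/
def fast2MultExact (RN : ℝ → ℝ) (a b : ℝ) : List ℝ :=
  [a * b, a * b - RN (a * b)]

/-- Fast2Sum: `h = RN (a + b)`, `z = RN (h - a)`, `l = RN (b - z)`. -/
def fast2Sum (RN : ℝ → ℝ) (a b : ℝ) : ℝ × ℝ :=
  (RN (a + b), RN (b - RN (RN (a + b) - a)))

/-- The exact values that are rounded in `fast2Sum RN a b`. -/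
def fast2SumExact (RN : ℝ → ℝ) (a b : ℝ) : List ℝ :=
  [a + b, RN (a + b) - a, b - RN (RN (a + b) - a)]

section Borges

variable (RN : ℝ → ℝ) (x y : ℝ)

/-- The first operand after the conditional swap. -/
def opX : ℝ := if |x| < |y| then y else x

/-- The second operand after the conditional swap. -/
def opY : ℝ := if |x| < |y| then x else y

def sxh : ℝ := (fast2Mult RN (opX x y) (opX x y)).1

def sxl : ℝ := (fast2Mult RN (opX x y) (opX x y)).2

def syh : ℝ := (fast2Mult RN (opY x y) (opY x y)).1

def syl : ℝ := (fast2Mult RN (opY x y) (opY x y)).2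

def sigmah : ℝ := (fast2Sum RN (sxh RN x y) (syh RN x y)).1

def sigmal : ℝ := (fast2Sum RN (sxh RN x y) (syh RN x y)).2

def sqrtApprox : ℝ := RN (√(sigmah RN x y))

def deltas : ℝ := RN (sigmah RN x y - sqrtApprox RN x y ^ 2)

def tau1 : ℝ := RN (sxl RN x y + syl RN x y)

def tau2 : ℝ := RN (deltas RN x y + sigmal RN x y)

def tau : ℝ := RN (tau1 RN x y + tau2 RN x y)

def corr : ℝ := RN (tau RN x y / sqrtApprox RN x y)

/-- The value returned by Borges' corrected fused algorithm. -/
def borgesFused : ℝ := RN (corr RN x y / 2 + sqrtApprox RN x y)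

/-- All the exact values that are rounded in the execution of Borges' corrected fused algorithm. -/
def borgesExact : List ℝ :=
  fast2MultExact RN (opX x y) (opX x y) ++
  fast2MultExact RN (opY x y) (opY x y) ++
  fast2SumExact RN (sxh RN x y) (syh RN x y) ++
  [√(sigmah RN x y),
   sigmah RN x y - sqrtApprox RN x y ^ 2,
   sxl RN x y + syl RN x y,
   deltas RN x y + sigmal RN x y,
   tau1 RN x y + tau2 RN x y,
   tau RN x y / sqrtApprox RN x y,
   corr RN x y / 2 + sqrtApprox RN x y]

end Borges

/-- No operation in the execution of the algorithm overflows or underflows. -/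
def NoException (p : ℕ) (emin emax : ℤ) (RN : ℝ → ℝ) (x y : ℝ) : Prop :=
  ∀ t ∈ borgesExact RN x y, NoOverflow p emax t ∧ NoUnderflow p emin emax t

/-- Relative error of the approximation `r` to the nonzero value `t`. -/
def relError (r t : ℝ) : ℝ := |(r - t) / t|

end HypotFP

end

/-! Divide every quantity by the matching power of `r = √(x² + y²)`, so that the exact result is 1.
Then `τ` approximates `1 - s²` and `t = c/2 + s` is a Newton step, with `2s(t - 1) = (cs - τ) + (τ -
(1 - s²)) + (1 - s)²`. To leading order `|τ| ≤ 4u`, `|τ₁ + τ₂ - (1 - s²)| ≤ 8u²` and `|1 - s| ≤ 2u`,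
hence `|t - 1| ≤ 10u²` (`abs_sub_one_le_general`); the final rounding would make this `u + 10u²`.

The constant drops to 7 because the worst cases of the two errors exclude each other. Split at `|c|
= (11/5)us`. A smaller `c` forces `|τ| ≤ 2.2u` and `|1 - s| ≤ 1.1u` to leading order, so `|t - 1|`
is about `(2.2 + 2.2 + 8 + 1.21)u²/2 < 6.81u²` (`abs_sub_one_le_of_small`). With a larger `c`, the
final rounding errs by at most `0.9ut` (`rounding_corrected_error`): an error close to `ut` needs
`t` just above a power of two and near a midpoint, whereas there `c/2` moves the floating-point
number `s` close to another one. The saving of `0.1u` outweighs `3u²` once `u ≤ 1/64`. For `p = 4,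
5` the bound with 10 suffices, since `κ` is large there. -/

namespace HypotFP

/-! ### Rounding to nearest: error bounds and monotonicity. -/

section Rounding

variable {p : ℕ} {emin emax : ℤ} {RN : ℝ → ℝ} {t : ℝ}

lemma zpow_sub_add_one_eq (p : ℕ) (e : ℤ) :
    (2 : ℝ) ^ p * (2 : ℝ) ^ (e - (p : ℤ) + 1) = 2 ^ (e + 1) := by
  rw [← zpow_natCast, ← zpow_add₀ two_ne_zero]
  congr 1; ring

lemma zpow_sub_eq_unitRoundoff_mul (p : ℕ) (e : ℤ) :
    (2 : ℝ) ^ (e - (p : ℤ)) = unitRoundoff p * 2 ^ e := by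
  rw [unitRoundoff, ← zpow_add₀ two_ne_zero]
  congr 1; ring

lemma zpow_sub_add_one_eq_unitRoundoff_mul (p : ℕ) (e : ℤ) :
    (2 : ℝ) ^ (e - (p : ℤ) + 1) = 2 * (unitRoundoff p * 2 ^ e) := by
  rw [zpow_add_one₀ two_ne_zero, zpow_sub_eq_unitRoundoff_mul]
  ring

lemma isFP_zpow {e : ℤ} (hp : 1 ≤ p) (h₁ : emin ≤ e) (h₂ : e ≤ emax) :
    IsFP p emin emax ((2 : ℝ) ^ e) := by
  refine ⟨2 ^ (p - 1), e, ?_, h₁, h₂, ?_⟩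
  · obtain ⟨n, rfl⟩ := Nat.exists_eq_add_of_le' hp
    have : (1 : ℤ) ≤ 2 ^ n := one_le_pow₀ (by norm_num)
    rw [abs_of_nonneg (by positivity)]
    simp only [Nat.add_sub_cancel, pow_succ]
    linarith
  · push_cast
    rw [← zpow_natCast, ← zpow_add₀ two_ne_zero]
    congr 1
    push_cast [Nat.cast_sub hp]
    ring

lemma IsFP.neg {x : ℝ} (hx : IsFP p emin emax x) : IsFP p emin emax (-x) := by
  obtain ⟨M, e, hM, h₁, h₂, rfl⟩ := hx
  exact ⟨-M, e, by rwa [abs_neg], h₁, h₂, by push_cast; ring⟩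

lemma NoOverflow.abs_lt (ht : NoOverflow p emax t) : |t| < (2 : ℝ) ^ (emax + 1) := by
  unfold NoOverflow largestFP at ht
  have h := zpow_sub_add_one_eq p emax
  have h' : (2 : ℝ) ^ (emax - (p : ℤ) + 1) = 2 * 2 ^ (emax - (p : ℤ)) := by
    rw [zpow_add_one₀ two_ne_zero]; ring
  have : (0 : ℝ) < 2 ^ (emax - (p : ℤ)) := by positivity
  rw [sub_mul] at ht
  linarith

lemma rounding_eq_self (hRN : IsRoundToNearest p emin emax RN) (hov : NoOverflow p emax t)
    (ht : IsFP p emin emax t) : RN t = t := by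
  have h := (hRN t hov).2 t ht
  rw [sub_self, abs_zero] at h
  linarith [abs_eq_zero.1 (le_antisymm h (abs_nonneg _))]

/-- A rounding is either exact, or its error is at most half a unit in the last place. -/
lemma rounding_error_le_half_ulp (hp : 1 ≤ p) (hRN : IsRoundToNearest p emin emax RN)
    (hov : NoOverflow p emax t) (hun : NoUnderflow p emin emax t) :
    RN t = t ∨ ∃ e, emin ≤ e ∧ e ≤ emax ∧ (2 : ℝ) ^ e ≤ |t| ∧ |t| < 2 ^ (e + 1) ∧
      |t - RN t| ≤ unitRoundoff p * 2 ^ e := by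
  rcases hun with hun | hun
  swap
  · exact Or.inl (rounding_eq_self hRN hov hun)
  right
  have hpos : 0 < |t| := lt_of_lt_of_le (by positivity) hun
  obtain ⟨e, he₁, he₂⟩ := exists_mem_Ico_zpow hpos one_lt_two
  have hemin : emin ≤ e := by
    have := (zpow_lt_zpow_iff_right₀ (one_lt_two (α := ℝ))).1 (hun.trans_lt he₂)
    omega
  have hemax : e ≤ emax := by
    have := (zpow_lt_zpow_iff_right₀ (one_lt_two (α := ℝ))).1 (he₁.trans_lt hov.abs_lt)
    omega
  refine ⟨e, hemin, hemax, he₁, he₂, ?_⟩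
  set q : ℝ := (2 : ℝ) ^ (e - (p : ℤ) + 1) with hq
  have hq0 : 0 < q := by positivity
  have hqu : q = 2 * (unitRoundoff p * 2 ^ e) := zpow_sub_add_one_eq_unitRoundoff_mul p e
  have hqe : (2 : ℝ) ^ p * q = 2 ^ (e + 1) := zpow_sub_add_one_eq p e
  set M : ℤ := round (t / q) with hM
  have hr : |t / q - M| ≤ 1 / 2 := abs_sub_round _
  have herr : |t - M * q| ≤ unitRoundoff p * 2 ^ e := by
    have : t - M * q = (t / q - M) * q := by field_simp
    rw [this, abs_mul, abs_of_pos hq0]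
    nlinarith
  have htq : |t / q| < 2 ^ p := by
    rw [abs_div, abs_of_pos hq0, div_lt_iff₀ hq0, hqe]; exact he₂
  have hMr : |(M : ℝ)| ≤ |t / q| + 1 / 2 := by
    have := abs_sub_abs_le_abs_sub (M : ℝ) (t / q)
    rw [abs_sub_comm] at this
    linarith
  have hMle : |M| ≤ 2 ^ p := by
    have : ((|M| : ℤ) : ℝ) < ((2 ^ p + 1 : ℤ) : ℝ) := by push_cast; linarith
    have := Int.cast_lt.1 this
    omega
  refine le_trans ((hRN t hov).2 (M * q) ?_) herr
  rcases lt_or_eq_of_le hMle with hlt | heq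
  · exact ⟨M, e, by omega, hemin, hemax, rfl⟩
  -- The mantissa rounds up to `2 ^ p`, so the candidate is `±2 ^ (e + 1)`. In the top binade the
  -- half-ulp margin in `NoOverflow` rules this out.
  · have hlt : e < emax := by
      refine lt_of_le_of_ne hemax fun h => ?_
      subst h
      have hov' : |t| < (2 ^ p - 1) * q + q / 2 := by
        have h2 : q / 2 = (2 : ℝ) ^ (e - (p : ℤ)) := by
          rw [hq, zpow_add_one₀ two_ne_zero]; ring
        rw [h2]; exact hov
      have h3 : |t / q| < 2 ^ p - 1 / 2 := by
        rw [abs_div, abs_of_pos hq0, div_lt_iff₀ hq0]; linarith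
      have h4 : |(M : ℝ)| = 2 ^ p := by
        have : ((|M| : ℤ) : ℝ) = ((2 ^ p : ℤ) : ℝ) := by rw [heq]
        push_cast at this; exact this
      linarith
    have hfp : IsFP p emin emax ((2 : ℝ) ^ (e + 1)) := isFP_zpow hp (by omega) (by omega)
    rcases abs_eq (by positivity) |>.1 heq with h | h
    · rw [h]; push_cast; rw [hqe]; exact hfp
    · rw [h]; push_cast; rw [neg_mul, hqe]; exact hfp.neg

lemma unitRoundoff_pos (p : ℕ) : 0 < unitRoundoff p := by unfold unitRoundoff; positivity

lemma rounding_rel_error (hp : 1 ≤ p) (hRN : IsRoundToNearest p emin emax RN)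
    (h : NoOverflow p emax t ∧ NoUnderflow p emin emax t) :
    |RN t - t| ≤ unitRoundoff p * |t| := by
  have hu := unitRoundoff_pos p
  rcases rounding_error_le_half_ulp hp hRN h.1 h.2 with h | ⟨e, -, -, h₁, -, h₂⟩
  · rw [h, sub_self, abs_zero]; positivity
  · rw [abs_sub_comm]
    exact h₂.trans (by gcongr)

/-- Below `2 ^ (k + 1)`, the error of a rounding is at most `2 ^ (k - p)`. -/
lemma rounding_error_le_of_abs_le (hp : 1 ≤ p) (hRN : IsRoundToNearest p emin emax RN)
    (h : NoOverflow p emax t ∧ NoUnderflow p emin emax t) {k : ℤ} (hk : |t| ≤ 2 ^ (k + 1)) :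
    |RN t - t| ≤ unitRoundoff p * 2 ^ k := by
  have hu := unitRoundoff_pos p
  rcases rounding_error_le_half_ulp hp hRN h.1 h.2 with h' | ⟨e, he₁, he₂, h₁, -, h₂⟩
  · rw [h', sub_self, abs_zero]; positivity
  · have hek : e ≤ k + 1 := (zpow_le_zpow_iff_right₀ (one_lt_two (α := ℝ))).1 (h₁.trans hk)
    rcases lt_or_eq_of_le hek with hlt | rfl
    · rw [abs_sub_comm]
      refine h₂.trans ?_
      gcongr
      · norm_num
      · omega
    -- The endpoint `|t| = 2 ^ (k + 1)` lies in the next binade, but is rounded exactly.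
    · have hfp : IsFP p emin emax t := by
        have hfp : IsFP p emin emax ((2 : ℝ) ^ (k + 1)) := isFP_zpow hp he₁ he₂
        rcases abs_eq (by positivity) |>.1 (le_antisymm hk h₁) with h | h <;> rw [h]
        exacts [hfp, hfp.neg]
      rw [rounding_eq_self hRN h.1 hfp, sub_self, abs_zero]; positivity

/-- Adding the squares of the two minimality inequalities gives `(t' - t)(RN t' - RN t) ≥ 0`,
whatever the tie-breaking rule. -/
lemma rounding_mono (hRN : IsRoundToNearest p emin emax RN) {t' : ℝ}
    (h : NoOverflow p emax t) (h' : NoOverflow p emax t') (hle : t ≤ t') : RN t ≤ RN t' := by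
  rcases eq_or_lt_of_le hle with rfl | hlt
  · exact le_rfl
  by_contra! hc
  have h1 := (hRN t h).2 _ (hRN t' h').1
  have h2 := (hRN t' h').2 _ (hRN t h).1
  have h1' := sq_le_sq.2 h1
  have h2' := sq_le_sq.2 h2
  nlinarith [mul_pos (sub_pos.2 hlt) (sub_pos.2 hc)]

lemma le_rounding_of_isFP (hRN : IsRoundToNearest p emin emax RN) (h : NoOverflow p emax t)
    {f : ℝ} (hf : IsFP p emin emax f) (hft : f ≤ t) : f ≤ RN t := by
  by_contra! hc
  have h1 := (hRN t h).2 f hf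
  rw [abs_of_nonneg (by linarith), abs_of_nonneg (by linarith)] at h1
  linarith

lemma rounding_le_of_isFP (hRN : IsRoundToNearest p emin emax RN) (h : NoOverflow p emax t)
    {f : ℝ} (hf : IsFP p emin emax f) (htf : t ≤ f) : RN t ≤ f := by
  by_contra! hc
  have h1 := (hRN t h).2 f hf
  rw [abs_of_nonpos (by linarith), abs_of_nonpos (by linarith)] at h1
  linarith

/-! ### Exact subtraction, and neighbours of a floating-point number. -/

/-- Sterbenz' lemma, for `a ≤ b ≤ 2a`. -/
lemma IsFP.sub_of_le_two_mul {a b : ℝ} (ha : IsFP p emin emax a) (hb : IsFP p emin emax b)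
    (hab : a ≤ b) (hba : b ≤ 2 * a) : IsFP p emin emax (b - a) := by
  have ha0 : 0 ≤ a := by linarith
  obtain ⟨M, e, hM, he₁, he₂, hMa⟩ := ha
  obtain ⟨N, f, hN, hf₁, hf₂, hNb⟩ := hb
  -- The difference is a multiple of the finer of the two quanta and does not exceed the operand
  -- that has this quantum, so its mantissa fits too.
  have key : ∀ (K L : ℤ) (d : ℤ), |K| ≤ 2 ^ p - 1 → emin ≤ d → d ≤ emax →
      b - a = L * (2 : ℝ) ^ (d - (p : ℤ) + 1) → b - a ≤ K * (2 : ℝ) ^ (d - (p : ℤ) + 1) →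
      IsFP p emin emax (b - a) := by
    intro K L d hK hd₁ hd₂ hL hle
    refine ⟨L, d, ?_, hd₁, hd₂, hL⟩
    have hq : (0 : ℝ) < (2 : ℝ) ^ (d - (p : ℤ) + 1) := by positivity
    have hL0 : 0 ≤ L := by
      have : (0 : ℝ) ≤ L * (2 : ℝ) ^ (d - (p : ℤ) + 1) := by rw [← hL]; linarith
      exact_mod_cast nonneg_of_mul_nonneg_left this hq
    have hLK : L ≤ K := by
      rw [hL] at hle
      exact_mod_cast le_of_mul_le_mul_right hle hq
    rw [abs_of_nonneg hL0]
    exact hLK.trans ((le_abs_self K).trans hK)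
  have scale : ∀ d d' : ℤ, d ≤ d' → ∃ n : ℤ,
      (2 : ℝ) ^ (d' - (p : ℤ) + 1) = n * (2 : ℝ) ^ (d - (p : ℤ) + 1) := by
    intro d d' hd
    obtain ⟨n, rfl⟩ := Int.le.dest hd
    refine ⟨2 ^ n, ?_⟩
    push_cast
    rw [← zpow_natCast, ← zpow_add₀ two_ne_zero]
    congr 1; ring
  rcases le_total e f with h | h
  · obtain ⟨n, hn⟩ := scale _ _ h
    refine key M (N * n - M) e hM he₁ he₂ ?_ (by linarith)
    rw [hMa, hNb, hn]; push_cast; ring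
  · obtain ⟨n, hn⟩ := scale _ _ h
    refine key N (N - M * n) f hN hf₁ hf₂ ?_ (by linarith)
    rw [hMa, hNb, hn]; push_cast; ring

lemma IsFP.le_largestFP {x : ℝ} (hx : IsFP p emin emax x) : x ≤ largestFP p emax := by
  obtain ⟨M, e, hM, -, he, rfl⟩ := hx
  have h1 : (M : ℝ) ≤ 2 ^ p - 1 := by
    have : M ≤ 2 ^ p - 1 := (le_abs_self M).trans hM
    exact_mod_cast this
  have h2 : (0 : ℝ) ≤ 2 ^ p - 1 := sub_nonneg.2 (one_le_pow₀ one_le_two)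
  unfold largestFP
  gcongr
  norm_num

/-- The doubling of a floating-point number either is one, or exceeds all of them. -/
lemma IsFP.two_mul_or {x : ℝ} (hx : IsFP p emin emax x) (hx0 : 0 ≤ x) :
    IsFP p emin emax (2 * x) ∨ largestFP p emax < 2 * x := by
  obtain ⟨M, e, hM, he₁, he₂, rfl⟩ := hx
  rcases lt_or_eq_of_le he₂ with h | rfl
  · left
    refine ⟨M, e + 1, hM, by omega, by omega, ?_⟩
    rw [show e + 1 - (p : ℤ) + 1 = e - (p : ℤ) + 1 + 1 by ring,
      zpow_add_one₀ two_ne_zero (e - (p : ℤ) + 1)]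
    ring
  · by_cases h : 2 * M ≤ 2 ^ p - 1
    · left
      have hM0 : 0 ≤ M := by exact_mod_cast nonneg_of_mul_nonneg_left hx0 (by positivity)
      exact ⟨2 * M, e, by rwa [abs_of_nonneg (by omega)], he₁, he₂, by push_cast; ring⟩
    · right
      unfold largestFP
      rw [← mul_assoc]
      gcongr
      have : (2 ^ p - 1 : ℤ) < 2 * M := by omega
      exact_mod_cast this

/-- The subtraction in Fast2Sum is exact. -/
lemma isFP_rounding_add_sub (hRN : IsRoundToNearest p emin emax RN) {a b : ℝ}
    (ha : IsFP p emin emax a) (hb : 0 ≤ b) (hba : b ≤ a) (h : NoOverflow p emax (a + b)) :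
    IsFP p emin emax (RN (a + b) - a) := by
  have hfp := (hRN _ h).1
  refine ha.sub_of_le_two_mul hfp (le_rounding_of_isFP hRN h ha (by linarith)) ?_
  -- Sterbenz requires `RN (a + b) ≤ 2 * a`, also when `2 * a` is beyond the floating-point range.
  rcases ha.two_mul_or (hb.trans hba) with h2 | h2
  · exact rounding_le_of_isFP hRN h h2 (by linarith)
  · exact hfp.le_largestFP.trans h2.le

/-- A floating-point number below a power of two is separated from it. -/
lemma IsFP.le_pred_of_lt {x : ℝ} (hx : IsFP p emin emax x) {j : ℤ} (h : x < 2 ^ j) :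
    x ≤ 2 ^ j * (1 - unitRoundoff p) := by
  obtain ⟨M, e, hM, -, -, rfl⟩ := hx
  set v : ℝ := (2 : ℝ) ^ (j - (p : ℤ)) with hv
  have hv0 : 0 < v := by positivity
  have hjv : (2 : ℝ) ^ j = 2 ^ p * v := by
    rw [hv, ← zpow_natCast, ← zpow_add₀ two_ne_zero]; congr 1; ring
  have hvu : v = unitRoundoff p * 2 ^ j := zpow_sub_eq_unitRoundoff_mul p j
  have hgoal : (2 : ℝ) ^ j * (1 - unitRoundoff p) = (2 ^ p - 1) * v := by
    rw [mul_one_sub, sub_mul, one_mul, ← hjv, hvu]; ring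
  rw [hgoal]
  rcases le_total (j - (p : ℤ)) (e - (p : ℤ) + 1) with hle | hle
  · obtain ⟨n, hn⟩ := Int.le.dest hle
    have hpow : (2 : ℝ) ^ (e - (p : ℤ) + 1) = 2 ^ n * v := by
      rw [← hn, zpow_add₀ two_ne_zero, zpow_natCast]; ring
    rw [hpow, hjv, ← mul_assoc] at h
    have h1 : (M : ℝ) * 2 ^ n < 2 ^ p := lt_of_mul_lt_mul_right h hv0.le
    have h2 : M * 2 ^ n < 2 ^ p := by exact_mod_cast h1
    have h3 : M * 2 ^ n ≤ 2 ^ p - 1 := by omega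
    have h4 : (M : ℝ) * 2 ^ n ≤ 2 ^ p - 1 := by exact_mod_cast h3
    rw [hpow, ← mul_assoc]
    gcongr
  · have h1 : (M : ℝ) ≤ 2 ^ p - 1 := by
      have : M ≤ 2 ^ p - 1 := (le_abs_self M).trans hM
      exact_mod_cast this
    have h2 : (0 : ℝ) ≤ 2 ^ p - 1 := sub_nonneg.2 (one_le_pow₀ one_le_two)
    have h3 : (2 : ℝ) ^ (e - (p : ℤ) + 1) ≤ v := zpow_le_zpow_right₀ one_le_two hle
    gcongr

/-- The neighbours of a floating-point number in the lower part of a binade. -/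
lemma IsFP.add_sign_mul_ulp {x : ℝ} (hx : IsFP p emin emax x) {j : ℤ} (hj₁ : emin ≤ j)
    (hj₂ : j ≤ emax) (h₁ : 2 ^ j ≤ x) (h₂ : x + 2 * (unitRoundoff p * 2 ^ j) < 2 ^ (j + 1))
    {n : ℤ} (hn : |n| ≤ 1) :
    IsFP p emin emax (x + n * (2 * (unitRoundoff p * 2 ^ j))) := by
  obtain ⟨M, e, hM, -, -, hMx⟩ := hx
  set q : ℝ := (2 : ℝ) ^ (j - (p : ℤ) + 1) with hq
  have hq0 : 0 < q := by positivity
  have hqu : 2 * (unitRoundoff p * 2 ^ j) = q := (zpow_sub_add_one_eq_unitRoundoff_mul p j).symm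
  have hqj : (2 : ℝ) ^ p * q = 2 ^ (j + 1) := zpow_sub_add_one_eq p j
  -- The size of `x` forces its exponent to be at least `j`, so `x` is an integer multiple of the
  -- ulp `q` of the binade.
  have hje : j ≤ e := by
    by_contra! hc
    have hM' : (M : ℝ) < 2 ^ p := by
      have : M < 2 ^ p := by have := le_abs_self M; omega
      exact_mod_cast this
    have : x < 2 ^ (e + 1) := by
      rw [hMx, ← zpow_sub_add_one_eq p e]
      gcongr
    have := (zpow_lt_zpow_iff_right₀ (one_lt_two (α := ℝ))).1 (h₁.trans_lt this)
    omega
  obtain ⟨m, rfl⟩ := Int.le.dest hje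
  have hpow : (2 : ℝ) ^ (j + m - (p : ℤ) + 1) = 2 ^ m * q := by
    rw [hq, ← zpow_natCast, ← zpow_add₀ two_ne_zero]; congr 1; ring
  have hx' : x = ((M * 2 ^ m : ℤ) : ℝ) * q := by rw [hMx, hpow]; push_cast; ring
  set N : ℤ := M * 2 ^ m
  rw [hqu] at h₂ ⊢
  have hN1 : N + 1 < 2 ^ p := by
    rw [hx', ← hqj] at h₂
    have : ((N : ℝ) + 1) * q < 2 ^ p * q := by linarith
    exact_mod_cast lt_of_mul_lt_mul_right this hq0.le
  have hN0 : 0 < N := by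
    have : (0 : ℝ) < N * q := by rw [← hx']; exact lt_of_lt_of_le (by positivity) h₁
    exact_mod_cast pos_of_mul_pos_left this hq0.le
  refine ⟨N + n, j, ?_, hj₁, hj₂, by rw [hx']; push_cast; ring⟩
  have := abs_le.1 hn
  rw [abs_le]
  constructor <;> omega

end Rounding


/-! ### Error analysis of a normalised run, before the final rounding. -/

/-- The relations between the quantities computed by the algorithm when every operation commits a
relative error of at most `u`, all of them being scaled so that the exact result is `1`. -/
structure ScaledRun (u X Y A B sxl syl H sl q s δ τ₁ τ₂ τ c : ℝ) : Prop where
  u_pos : 0 < u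
  X_nonneg : 0 ≤ X
  Y_nonneg : 0 ≤ Y
  X_add_Y : X + Y = 1
  A_err : |A - X| ≤ u * |X|
  B_err : |B - Y| ≤ u * |Y|
  sxl_err : |sxl - (X - A)| ≤ u * |X - A|
  syl_err : |syl - (Y - B)| ≤ u * |Y - B|
  H_err : |H - (A + B)| ≤ u * |A + B|
  sl_err : |sl - (A + B - H)| ≤ u * |A + B - H|
  q_nonneg : 0 ≤ q
  q_sq : q ^ 2 = H
  s_err : |s - q| ≤ u * |q|
  δ_err : |δ - (H - s ^ 2)| ≤ u * |H - s ^ 2|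
  τ₁_err : |τ₁ - (sxl + syl)| ≤ u * |sxl + syl|
  τ₂_err : |τ₂ - (δ + sl)| ≤ u * |δ + sl|
  τ_err : |τ - (τ₁ + τ₂)| ≤ u * |τ₁ + τ₂|
  c_err : |c - τ / s| ≤ u * |τ / s|

lemma rel_bound {u a b β : ℝ} (hu : 0 ≤ u) (h : |a - b| ≤ u * |b|) (hb : |b| ≤ β) :
    |a - b| ≤ u * β ∧ |a| ≤ (1 + u) * β := by
  have h1 : |a - b| ≤ u * β := h.trans (by gcongr)
  have h2 : |a| - |b| ≤ |a - b| := abs_sub_abs_le_abs_sub a b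
  exact ⟨h1, by linarith⟩

lemma abs_le_div_of_rel_error {u a b : ℝ} (hu : u < 1) (h : |a - b| ≤ u * |b|) :
    |b| ≤ |a| / (1 - u) := by
  rw [le_div_iff₀ (by linarith)]
  have h2 : |b| - |a| ≤ |b - a| := abs_sub_abs_le_abs_sub b a
  rw [abs_sub_comm] at h2
  linarith

namespace ScaledRun

variable {u X Y A B sxl syl H sl q s δ τ₁ τ₂ τ c : ℝ}

lemma abs_add_err (h : ScaledRun u X Y A B sxl syl H sl q s δ τ₁ τ₂ τ c) :
    |X - A| + |Y - B| ≤ u := by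
  have h1 := h.A_err
  have h2 := h.B_err
  rw [abs_of_nonneg h.X_nonneg] at h1
  rw [abs_of_nonneg h.Y_nonneg] at h2
  rw [abs_sub_comm X, abs_sub_comm Y]
  calc _ ≤ u * X + u * Y := add_le_add h1 h2
    _ = u := by rw [← mul_add, h.X_add_Y, mul_one]

lemma abs_add_sub_one_le (h : ScaledRun u X Y A B sxl syl H sl q s δ τ₁ τ₂ τ c) :
    |A + B - 1| ≤ u := by
  have h1 := abs_add_le (X - A) (Y - B)
  have h2 := h.abs_add_err
  rw [abs_sub_comm, ← h.X_add_Y, show X + Y - (A + B) = X - A + (Y - B) by ring]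
  linarith

lemma abs_add_le_one_add (h : ScaledRun u X Y A B sxl syl H sl q s δ τ₁ τ₂ τ c) :
    |A + B| ≤ 1 + u := by
  have h1 := abs_le.1 h.abs_add_sub_one_le
  have := h.u_pos
  rw [abs_le]; constructor <;> linarith

/-- The low parts are rounded errors: their own relative error `u` acts on terms whose sizes sum to
at most `u`, because `X + Y = 1`. -/
lemma low_parts (h : ScaledRun u X Y A B sxl syl H sl q s δ τ₁ τ₂ τ c) :
    |sxl + syl - (1 - (A + B))| ≤ u ^ 2 ∧ |sxl + syl| ≤ u * (1 + u) := by
  have hu := h.u_pos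
  have h1 : |sxl + syl - (1 - (A + B))| ≤ u ^ 2 := by
    have e : sxl + syl - (1 - (A + B)) = (sxl - (X - A)) + (syl - (Y - B)) := by
      rw [← h.X_add_Y]; ring
    rw [e]
    refine (abs_add_le _ _).trans ((add_le_add h.sxl_err h.syl_err).trans ?_)
    have := h.abs_add_err
    nlinarith
  refine ⟨h1, ?_⟩
  have h2 := h.abs_add_sub_one_le
  rw [abs_sub_comm] at h2
  have h3 := abs_sub_abs_le_abs_sub (sxl + syl) (1 - (A + B))
  nlinarith

lemma H_bound (h : ScaledRun u X Y A B sxl syl H sl q s δ τ₁ τ₂ τ c) :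
    |A + B - H| ≤ u * (1 + u) := by
  rw [abs_sub_comm]
  exact (rel_bound h.u_pos.le h.H_err h.abs_add_le_one_add).1

lemma sl_bound (h : ScaledRun u X Y A B sxl syl H sl q s δ τ₁ τ₂ τ c) :
    |sl - (A + B - H)| ≤ u * (u * (1 + u)) ∧ |sl| ≤ (1 + u) * (u * (1 + u)) :=
  rel_bound h.u_pos.le h.sl_err h.H_bound

lemma q_bound (h : ScaledRun u X Y A B sxl syl H sl q s δ τ₁ τ₂ τ c) (hu1 : u < 1) :
    1 - u ≤ q ∧ q ≤ 1 + u := by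
  have hu := h.u_pos
  have hq := h.q_nonneg
  have h1 := abs_le.1 h.abs_add_sub_one_le
  have h2 := h.H_err
  rw [abs_of_nonneg (by linarith : 0 ≤ A + B)] at h2
  have h2 := abs_le.1 h2
  have h3 := h.q_sq
  constructor
  · refine le_of_sq_le_sq ?_ hq
    nlinarith
  · refine le_of_sq_le_sq ?_ (by linarith)
    nlinarith

lemma s_bound (h : ScaledRun u X Y A B sxl syl H sl q s δ τ₁ τ₂ τ c) (hu1 : u < 1) :
    (1 - u) ^ 2 ≤ s ∧ s ≤ (1 + u) ^ 2 ∧ (1 - u) * q ≤ s ∧ s ≤ (1 + u) * q := by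
  have hu := h.u_pos
  have hq := h.q_bound hu1
  have h1 := h.s_err
  rw [abs_of_nonneg h.q_nonneg] at h1
  have h1 := abs_le.1 h1
  refine ⟨?_, ?_, ?_, ?_⟩ <;> nlinarith

/-- Rests on `1 - s² = (1 - (A + B)) + (A + B - H) + (H - s²)`, whose summands are approximated by
`sxl + syl`, `sl` and `δ`. The bound `D` is left free since `|H - s²|` may be much smaller than its
worst case, about `2u`. -/
lemma tau_chain (h : ScaledRun u X Y A B sxl syl H sl q s δ τ₁ τ₂ τ c) {D : ℝ}
    (hD : |H - s ^ 2| ≤ D) :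
    |τ₁ + τ₂| ≤ (1 + u) ^ 2 * D + u * (1 + u) ^ 2 * (2 + u) ∧
    |τ₁ + τ₂ - (1 - s ^ 2)| ≤
      u ^ 2 + u ^ 2 * (1 + u) + u * D + u ^ 2 * (1 + u) + u * (1 + u) * (D + u * (1 + u)) := by
  have hu := h.u_pos.le
  obtain ⟨hL, hL'⟩ := h.low_parts
  obtain ⟨h1, h1'⟩ := rel_bound hu h.τ₁_err hL'
  obtain ⟨h2, h2'⟩ := rel_bound hu h.δ_err hD
  obtain ⟨h3, h3'⟩ := h.sl_bound
  have h4 : |δ + sl| ≤ (1 + u) * D + (1 + u) * (u * (1 + u)) :=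
    (abs_add_le _ _).trans (add_le_add h2' h3')
  obtain ⟨h5, h5'⟩ := rel_bound hu h.τ₂_err h4
  constructor
  · refine (abs_add_le _ _).trans ((add_le_add h1' h5').trans (le_of_eq ?_))
    ring
  · rw [abs_le] at *
    constructor <;> linarith

lemma abs_H_sub_le (h : ScaledRun u X Y A B sxl syl H sl q s δ τ₁ τ₂ τ c) (hu1 : u < 1) {w : ℝ}
    (hw : |s - q| ≤ w) : |H - s ^ 2| ≤ w * (q + s) := by
  have hq := h.q_nonneg
  have hs := (h.s_bound hu1).2.2.1
  have hs0 : 0 ≤ s := le_trans (mul_nonneg (by linarith) hq) hs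
  rw [← h.q_sq, sq_sub_sq, abs_mul, abs_of_nonneg (by positivity : 0 ≤ q + s), mul_comm,
    abs_sub_comm]
  gcongr

lemma abs_H_sub_le' (h : ScaledRun u X Y A B sxl syl H sl q s δ τ₁ τ₂ τ c) (hu : u ≤ 1 / 16) :
    |H - s ^ 2| ≤ u * (2 + 27 / 5 * u) := by
  have hu0 := h.u_pos
  have hq := h.q_bound (by linarith)
  have hs := h.s_bound (by linarith)
  have hw : |s - q| ≤ u * (1 + u) := h.s_err.trans (by
    rw [abs_of_nonneg h.q_nonneg]; gcongr; exact hq.2)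
  refine (h.abs_H_sub_le (by linarith) hw).trans ?_
  have h1 : q + s ≤ (1 + u) + (1 + u) ^ 2 := by linarith
  calc u * (1 + u) * (q + s) ≤ u * (1 + u) * ((1 + u) + (1 + u) ^ 2) := by gcongr
    _ = u * (2 + 5 * u + u * (4 * u + u ^ 2)) := by ring
    _ ≤ u * (2 + 5 * u + u * (2 / 5)) := by gcongr; nlinarith
    _ = _ := by ring

lemma tau_bounds (h : ScaledRun u X Y A B sxl syl H sl q s δ τ₁ τ₂ τ c) (hu : u ≤ 1 / 16) :
    |τ₁ + τ₂| ≤ u * (4 + 16 * u) ∧ |τ₁ + τ₂ - (1 - s ^ 2)| ≤ u ^ 2 * (8 + 18 * u) := by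
  have hu0 := h.u_pos
  obtain ⟨h1, h2⟩ := h.tau_chain (h.abs_H_sub_le' hu)
  have e2 : u ^ 2 ≤ u / 16 := by nlinarith
  have e3 : u ^ 3 ≤ u / 256 := by nlinarith
  constructor
  · refine h1.trans ?_
    calc _ = u * (4 + (72 / 5) * u + 84 / 5 * u ^ 2 + 32 / 5 * u ^ 3) := by ring
      _ ≤ _ := mul_le_mul_of_nonneg_left (by linarith) hu0.le
  · refine h2.trans ?_
    calc _ = u ^ 2 * (8 + 84 / 5 * u + 32 / 5 * u ^ 2) := by ring
      _ ≤ _ := mul_le_mul_of_nonneg_left (by linarith) (by positivity)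

/-- The error before the final rounding, in terms of those of its three sources. -/
lemma abs_sub_one_le (h : ScaledRun u X Y A B sxl syl H sl q s δ τ₁ τ₂ τ c) (hu1 : u < 1)
    {K E R : ℝ} (hK : |τ| ≤ K) (hE : |τ - (1 - s ^ 2)| ≤ E) (hR : |1 - s| ≤ R) :
    |c / 2 + s - 1| ≤ (u * K + E + R ^ 2) / (2 * (1 - u) ^ 2) := by
  have hu := h.u_pos
  have hs := (h.s_bound hu1).1
  have hs1 : 0 < (1 - u) ^ 2 := pow_pos (by linarith) 2
  have hs0 : 0 < s := hs1.trans_le hs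
  have h1 : |c - τ / s| * s ≤ u * K := by
    have h := h.c_err
    rw [abs_div, abs_of_pos hs0, mul_div_assoc', le_div_iff₀ hs0] at h
    exact h.trans (by gcongr)
  have hR2 : (1 - s) ^ 2 ≤ R ^ 2 := by
    rw [← sq_abs (1 - s)]; gcongr
  -- The three sources: the division, the computation of `τ`, and the quadratic remainder of the
  -- Newton step.
  have h2 : (c / 2 + s - 1) * (2 * s) = (c - τ / s) * s + (τ - (1 - s ^ 2)) + (1 - s) ^ 2 := by
    field_simp; ring
  have h3 : |c / 2 + s - 1| * (2 * s) ≤ u * K + E + R ^ 2 := by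
    have e : |c / 2 + s - 1| * (2 * s) = |(c / 2 + s - 1) * (2 * s)| := by
      rw [abs_mul, abs_of_pos (by positivity : 0 < 2 * s)]
    rw [e, h2]
    refine (abs_add_three _ _ _).trans ?_
    rw [abs_mul, abs_of_pos hs0, abs_of_nonneg (sq_nonneg (1 - s))]
    linarith
  rw [le_div_iff₀ (by positivity)]
  refine le_trans ?_ h3
  gcongr

lemma abs_sub_one_le_general (h : ScaledRun u X Y A B sxl syl H sl q s δ τ₁ τ₂ τ c)
    (hu : u ≤ 1 / 16) : |c / 2 + s - 1| ≤ u ^ 2 * (10 + 60 * u) := by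
  have hu0 := h.u_pos
  obtain ⟨h1, h2⟩ := h.tau_bounds hu
  obtain ⟨h3, h3'⟩ := rel_bound hu0.le h.τ_err h1
  have hs := h.s_bound (by linarith)
  have h4 : |1 - s| ≤ 2 * u + u ^ 2 := by
    rw [abs_le]; constructor <;> nlinarith
  have h5 : |τ - (1 - s ^ 2)| ≤ u * (u * (4 + 16 * u)) + u ^ 2 * (8 + 18 * u) := by
    refine (abs_sub_le _ (τ₁ + τ₂) _).trans (add_le_add h3 h2)
  refine (h.abs_sub_one_le (by linarith) h3' h5 h4).trans ?_
  have hs1 : 0 < (1 - u) ^ 2 := pow_pos (by linarith) 2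
  rw [div_le_iff₀ (by positivity)]
  have e2 : 0 ≤ u ^ 2 := by positivity
  have key : 4 + 20 * u + 16 * u ^ 2 + (4 + 16 * u) + (8 + 18 * u) + (2 + u) ^ 2 ≤
      (10 + 60 * u) * (2 * (1 - u) ^ 2) := by nlinarith [pow_pos hu0 3]
  nlinarith [mul_le_mul_of_nonneg_left key e2]

/-- The estimates run backwards: the bound on `c` bounds `τ`, then `τ₁ + τ₂`, and finally `1 - s²`,
whence `1 - s`. -/
lemma abs_sub_one_le_of_small (h : ScaledRun u X Y A B sxl syl H sl q s δ τ₁ τ₂ τ c)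
    (hu : u ≤ 1 / 64) (hc : |c| ≤ 11 / 5 * u * s) :
    |c / 2 + s - 1| ≤ u ^ 2 * (6.81 + 60 * u) := by
  have hu0 := h.u_pos
  obtain ⟨-, h2⟩ := h.tau_bounds (by linarith)
  have hs := h.s_bound (by linarith)
  have hs1 : 0 < (1 - u) ^ 2 := pow_pos (by linarith) 2
  have hs0 : 0 < s := hs1.trans_le hs.1
  have inv0 : 0 ≤ 1 / (1 - u) := one_div_nonneg.2 (by linarith)
  have inv : 1 / (1 - u) ≤ 1 + 65 / 63 * u := by
    rw [div_le_iff₀ (by linarith)]; nlinarith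
  have hτ : |τ| ≤ u * (2.2 + 11.7 * u) := by
    have h1 := abs_le_div_of_rel_error (by linarith) h.c_err
    rw [abs_div, abs_of_pos hs0, div_le_iff₀ hs0] at h1
    have hs2 : s * s ≤ (1 + u) ^ 2 * (1 + u) ^ 2 := by gcongr <;> exact hs.2.1
    calc |τ| ≤ |c| / (1 - u) * s := h1
      _ ≤ 11 / 5 * u * s / (1 - u) * s := by gcongr; linarith
      _ = 11 / 5 * u * (s * s) * (1 / (1 - u)) := by ring
      _ ≤ 11 / 5 * u * ((1 + u) ^ 2 * (1 + u) ^ 2) * (1 + 65 / 63 * u) := by gcongr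
      _ = u * (11 / 5 * ((1 + u) ^ 4 * (1 + 65 / 63 * u))) := by ring
      _ ≤ _ := by
        gcongr
        have e2 : u ^ 2 ≤ u / 64 := by nlinarith
        have e3 : u ^ 3 ≤ u / 64 ^ 2 := by nlinarith
        have e4 : u ^ 4 ≤ u / 64 ^ 3 := by nlinarith
        have e5 : u ^ 5 ≤ u / 64 ^ 4 := by nlinarith
        nlinarith
  have hτ' : |τ - (τ₁ + τ₂)| ≤ u ^ 2 * (2.2 + 14.3 * u) := by
    have h1 := abs_le_div_of_rel_error (by linarith) h.τ_err
    calc |τ - (τ₁ + τ₂)| ≤ u * |τ₁ + τ₂| := h.τ_err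
      _ ≤ u * (|τ| / (1 - u)) := by gcongr
      _ = u * (|τ| * (1 / (1 - u))) := by ring
      _ ≤ u * (u * (2.2 + 11.7 * u) * (1 + 65 / 63 * u)) := by gcongr
      _ = u ^ 2 * ((2.2 + 11.7 * u) * (1 + 65 / 63 * u)) := by ring
      _ ≤ _ := by gcongr; nlinarith
  have hE : |τ - (1 - s ^ 2)| ≤ u ^ 2 * (10.2 + 32.3 * u) := by
    refine (abs_sub_le _ (τ₁ + τ₂) _).trans ((add_le_add hτ' h2).trans (le_of_eq ?_))
    ring
  have hR : |1 - s| ≤ u * (1.1 + 13 * u) := by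
    have h1 : |1 - s ^ 2| ≤ u * (2.2 + 22.5 * u) := by
      have h1 := abs_sub_abs_le_abs_sub (1 - s ^ 2) τ
      rw [abs_sub_comm _ τ] at h1
      have h2 : u ^ 3 ≤ u ^ 2 / 64 := by nlinarith [sq_nonneg u]
      nlinarith
    have h2 : |1 - s ^ 2| = |1 - s| * (1 + s) := by
      rw [show 1 - s ^ 2 = (1 - s) * (1 + s) by ring, abs_mul, abs_of_pos (by linarith : 0 < 1 + s)]
    have h3 : 2 - 2 * u ≤ 1 + s := by nlinarith
    have h4 : |1 - s| * (2 - 2 * u) ≤ u * (2.2 + 22.5 * u) := by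
      refine le_trans ?_ (h2 ▸ h1)
      gcongr
    refine le_of_mul_le_mul_right (h4.trans ?_) (by linarith : 0 < 2 - 2 * u)
    rw [mul_assoc]
    gcongr
    nlinarith
  refine (h.abs_sub_one_le (by linarith) hτ hE hR).trans ?_
  rw [div_le_iff₀ (by positivity)]
  have e2 : 0 ≤ u ^ 2 := by positivity
  have key : (2.2 + 11.7 * u) + (10.2 + 32.3 * u) + (1.1 + 13 * u) ^ 2 ≤
      (6.81 + 60 * u) * (2 * (1 - u) ^ 2) := by nlinarith [pow_pos hu0 3]
  nlinarith [mul_le_mul_of_nonneg_left key e2]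

/-- To leading order `|c|/2 ≤ w + u`: the rounding error of the square root, plus those of the
squares and of their sum. The constants 1.09 and 1.15 absorb the higher-order terms for `u ≤ 1/64`.
-/
lemma abs_corr_le (h : ScaledRun u X Y A B sxl syl H sl q s δ τ₁ τ₂ τ c)
    (hu : u ≤ 1 / 64) {w : ℝ} (hw : |s - q| ≤ w) :
    |c| / 2 ≤ 1.09 * w + 1.15 * (u * s) := by
  have hu0 := h.u_pos
  have hw0 : 0 ≤ w := (abs_nonneg _).trans hw
  have hs := h.s_bound (by linarith)
  have hq := h.q_nonneg
  have hs1 : 0 < (1 - u) ^ 2 := pow_pos (by linarith) 2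
  have hs0 : 0 < s := hs1.trans_le hs.1
  obtain ⟨h1, -⟩ := h.tau_chain (h.abs_H_sub_le (by linarith) hw)
  obtain ⟨-, h2⟩ := rel_bound hu0.le h.τ_err h1
  have h3 : |c| * s ≤ (1 + u) * |τ| := by
    obtain ⟨-, h3⟩ := rel_bound hu0.le h.c_err le_rfl
    rwa [abs_div, abs_of_pos hs0, mul_div_assoc', le_div_iff₀ hs0] at h3
  -- From `(1 - u) * q ≤ s`, with `127/63 = 1 + 64/63`.
  have h4 : q + s ≤ 127 / 63 * s := by nlinarith
  have h5 : 1 ≤ 1.066 * (s * s) := by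
    have : (63 / 64 : ℝ) ^ 2 ≤ s := le_trans (by gcongr; linarith) hs.1
    nlinarith
  have hu' : 1 + u ≤ 65 / 64 := by linarith
  have hu'' : 2 + u ≤ 129 / 64 := by linarith
  have h6 : |c| * s ≤ (65 / 64) * ((65 / 64) * ((65 / 64) ^ 2 * (w * (127 / 63 * s)) +
      u * (65 / 64) ^ 2 * (129 / 64))) := by
    refine h3.trans ?_
    refine (mul_le_mul_of_nonneg_left h2 (by linarith)).trans ?_
    gcongr
  have h7 : |c| * s ≤ 2 * (1.09 * w + 1.15 * (u * s)) * s := by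
    have : u * 1 ≤ u * (1.066 * (s * s)) := by gcongr
    have : 0 ≤ w * s := by positivity
    have : 0 ≤ u * (s * s) := by positivity
    nlinarith
  have := le_of_mul_le_mul_right h7 hs0
  linarith

end ScaledRun

/-! ### The final rounding, and the link between the algorithm and the normalised run. -/

section Assembly

variable {p : ℕ} {emin emax : ℤ} {RN : ℝ → ℝ} {x y : ℝ}

lemma rounding_error_le_dist (hRN : IsRoundToNearest p emin emax RN) {t f : ℝ}
    (h : NoOverflow p emax t) (hf : IsFP p emin emax f) : |RN t - t| ≤ |t - f| := by
  rw [abs_sub_comm]; exact (hRN t h).2 f hf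

/-- When the correction is not small, the final rounding error is away from its worst case. -/
lemma rounding_corrected_error (hp : 1 ≤ p) (hRN : IsRoundToNearest p emin emax RN) {q c : ℝ}
    (hu : unitRoundoff p ≤ 1 / 64) (hq : 0 < q)
    (hexq : NoOverflow p emax q ∧ NoUnderflow p emin emax q)
    (hext : NoOverflow p emax (c / 2 + RN q) ∧ NoUnderflow p emin emax (c / 2 + RN q))
    (hc : 11 / 5 * unitRoundoff p * RN q < |c|)
    (hcw : ∀ w, |RN q - q| ≤ w → |c| / 2 ≤ 1.09 * w + 1.15 * (unitRoundoff p * RN q)) :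
    |RN (c / 2 + RN q) - (c / 2 + RN q)| ≤ 0.9 * (unitRoundoff p * (c / 2 + RN q)) := by
  have hu0 := unitRoundoff_pos p
  have hsq := rounding_rel_error hp hRN hexq
  have hsfp := (hRN q hexq.1).1
  have hmono := @le_rounding_of_isFP p emin emax RN q hRN hexq.1
  set u := unitRoundoff p
  set s := RN q with hs
  set t := c / 2 + s with ht
  rw [abs_of_pos hq] at hsq
  have hsq' := abs_le.1 hsq
  have hqs : q ≤ 64 / 63 * s := by nlinarith
  have hs0 : 0 < s := by linarith
  have hcs : |c| / 2 ≤ 0.04 * s := by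
    have h1 := hcw _ hsq
    have h2 : u * q ≤ 1 / 64 * (64 / 63 * s) := by gcongr
    have h3 : u * s ≤ 1 / 64 * s := by gcongr
    linarith
  have hc1 := le_abs_self c
  have hc2 := neg_abs_le c
  have ht0 : 0 < t := by linarith
  rcases rounding_error_le_half_ulp hp hRN hext.1 hext.2 with h | ⟨j, hj₁, hj₂, hjt, htj, hF⟩
  · rw [h, sub_self, abs_zero]; positivity
  rw [abs_of_pos ht0] at hjt htj
  rw [abs_sub_comm] at hF
  have hjfp : IsFP p emin emax ((2 : ℝ) ^ j) := isFP_zpow hp hj₁ hj₂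
  have hj2 : (2 : ℝ) ^ (j + 1) = 2 * 2 ^ j := by rw [zpow_add_one₀ two_ne_zero]; ring
  set h : ℝ := (2 : ℝ) ^ j with hh
  have hh0 : 0 < h := by positivity
  have huh : 0 < u * h := by positivity
  have hut : u * h ≤ u * t := by gcongr
  -- If `s < h ≤ t`, then `q ≤ h`, so the square root is rounded with half the error bound: `c/2 ≤
  -- 1.695uh`. Since `s` is at least `uh` below `h`, `t` exceeds `h` by at most `0.695uh`.
  rcases lt_or_ge s h with hsh | hsh
  · have hqh : q ≤ h := by
      by_contra! hlt
      exact absurd (hmono hjfp hlt.le) (not_le.2 hsh)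
    have hw : |s - q| ≤ u * (2 : ℝ) ^ (j - 1) :=
      rounding_error_le_of_abs_le hp hRN hexq (by rw [abs_of_pos hq, sub_add_cancel]; exact hqh)
    have hj1 : (2 : ℝ) ^ (j - 1) = h / 2 := by rw [zpow_sub_one₀ two_ne_zero]; ring
    rw [hj1] at hw
    have h1 := hcw _ hw
    have h2 : s ≤ h * (1 - u) := hsfp.le_pred_of_lt hsh
    have h3 : u * s ≤ u * h := by gcongr
    refine (rounding_error_le_dist hRN hext.1 hjfp).trans ?_
    rw [abs_of_nonneg (by linarith)]
    linarith
  -- Away from the bottom of the binade the half ulp `u * h` is at most `u * t / 1.2`.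
  rcases le_or_gt (1.2 * h) t with hth | hth
  · have : u * (1.2 * h) ≤ u * t := by gcongr
    linarith
  · have hs2 : s ≤ 1.25 * h := by linarith
    have hw : |s - q| ≤ u * h :=
      rounding_error_le_of_abs_le hp hRN hexq (by rw [abs_of_pos hq, hj2]; linarith)
    have h1 := hcw _ hw
    have h3 : u * s ≤ u * (1.25 * h) := by gcongr
    have h4 : u * h ≤ u * s := by gcongr
    have h5 : u * h ≤ 1 / 64 * h := by gcongr
    -- Here `1.1uh < |c|/2 ≤ 2.53uh`, while the neighbour of `s` on the side of `c` is `2uh` away;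
    -- so `t` is within `0.9uh` of it. This is where the threshold `11/5` comes from.
    have hnb : ∀ n : ℤ, |n| ≤ 1 → IsFP p emin emax (s + n * (2 * (u * h))) := fun n hn =>
      hsfp.add_sign_mul_ulp hj₁ hj₂ hsh (by rw [hj2]; linarith) hn
    rcases le_total 0 c with hc0 | hc0
    · rw [abs_of_nonneg hc0] at hc h1
      refine (rounding_error_le_dist hRN hext.1 (hnb 1 (by norm_num))).trans ?_
      push_cast
      rw [abs_le]
      constructor <;> linarith
    · rw [abs_of_nonpos hc0] at hc h1
      refine (rounding_error_le_dist hRN hext.1 (hnb (-1) (by norm_num))).trans ?_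
      push_cast
      rw [abs_le]
      constructor <;> linarith

lemma opX_sq_add_opY_sq (x y : ℝ) : opX x y * opX x y + opY x y * opY x y = x ^ 2 + y ^ 2 := by
  unfold opX opY
  split_ifs <;> ring

lemma opY_sq_le_opX_sq (x y : ℝ) : opY x y * opY x y ≤ opX x y * opX x y := by
  rw [← abs_le_iff_mul_self_le]
  unfold opX opY
  split_ifs with h <;> linarith

lemma rel_error_div {u a b d : ℝ} (hd : 0 < d) (h : |a - b| ≤ u * |b|) :
    |a / d - b / d| ≤ u * |b / d| := by
  rw [← sub_div, abs_div, abs_div, abs_of_pos hd, mul_div_assoc']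
  gcongr

/-- The second output of Fast2Sum is the correctly rounded error of the first. -/
lemma sigmal_eq (hRN : IsRoundToNearest p emin emax RN)
    (hex : NoException p emin emax RN x y) :
    sigmal RN x y = RN (sxh RN x y + syh RN x y - sigmah RN x y) ∧
    NoOverflow p emax (sxh RN x y + syh RN x y - sigmah RN x y) ∧
    NoUnderflow p emin emax (sxh RN x y + syh RN x y - sigmah RN x y) := by
  unfold NoException borgesExact fast2MultExact fast2SumExact at hex
  simp only [List.cons_append, List.nil_append, List.forall_mem_cons] at hex
  obtain ⟨hX, -, hY, -, hH, hZ, hL, -⟩ := hex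
  -- That the exponent range is nonempty is read off from an actual rounded value.
  have h0 : IsFP p emin emax 0 := by
    obtain ⟨M, e, hM, h₁, h₂, -⟩ := (hRN _ hX.1).1
    exact ⟨0, e, by rw [abs_zero]; exact (abs_nonneg M).trans hM, h₁, h₂, by simp⟩
  have hz : RN (RN (sxh RN x y + syh RN x y) - sxh RN x y) =
      RN (sxh RN x y + syh RN x y) - sxh RN x y :=
    rounding_eq_self hRN hZ.1 (isFP_rounding_add_sub hRN (hRN _ hX.1).1
      (le_rounding_of_isFP hRN hY.1 h0 (mul_self_nonneg _))
      (rounding_mono hRN hY.1 hX.1 (opY_sq_le_opX_sq x y)) hH.1)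
  have e : syh RN x y - RN (RN (sxh RN x y + syh RN x y) - sxh RN x y) =
      sxh RN x y + syh RN x y - sigmah RN x y := by
    rw [hz]; unfold sigmah fast2Sum; ring
  rw [e] at hL
  refine ⟨?_, hL⟩
  rw [← e]; rfl

lemma sigmah_pos (hp : 1 ≤ p) (hu : unitRoundoff p < 1) (hRN : IsRoundToNearest p emin emax RN)
    (hxy : 0 < x ^ 2 + y ^ 2) (hex : NoException p emin emax RN x y) : 0 < sigmah RN x y := by
  unfold NoException borgesExact fast2MultExact fast2SumExact at hex
  simp only [List.cons_append, List.nil_append, List.forall_mem_cons] at hex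
  obtain ⟨hX, -, hY, -, hH, -⟩ := hex
  have pos : ∀ {t : ℝ}, NoOverflow p emax t ∧ NoUnderflow p emin emax t → 0 ≤ t →
      (1 - unitRoundoff p) * t ≤ RN t := by
    intro t ht ht0
    have h := rounding_rel_error hp hRN ht
    rw [abs_of_nonneg ht0] at h
    linarith [(abs_le.1 h).1]
  have hu' : 0 < 1 - unitRoundoff p := by linarith
  have h1 := pos hX (mul_self_nonneg _)
  have h2 := pos hY (mul_self_nonneg _)
  have h3 : 0 < sxh RN x y + syh RN x y := by
    have := mul_pos hu' hxy
    rw [← opX_sq_add_opY_sq] at this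
    change 0 < RN _ + RN _
    linarith
  exact lt_of_lt_of_le (mul_pos hu' h3) (pos hH h3.le)

lemma scaledRun_of_noException (hp : 1 ≤ p) (hu : unitRoundoff p < 1)
    (hRN : IsRoundToNearest p emin emax RN) {r : ℝ} (hr : 0 < r) (hxy : x ^ 2 + y ^ 2 = r ^ 2)
    (hex : NoException p emin emax RN x y) :
    ScaledRun (unitRoundoff p) (opX x y * opX x y / r ^ 2) (opY x y * opY x y / r ^ 2)
      (sxh RN x y / r ^ 2) (syh RN x y / r ^ 2) (sxl RN x y / r ^ 2) (syl RN x y / r ^ 2)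
      (sigmah RN x y / r ^ 2) (sigmal RN x y / r ^ 2) (√(sigmah RN x y) / r)
      (sqrtApprox RN x y / r) (deltas RN x y / r ^ 2) (tau1 RN x y / r ^ 2)
      (tau2 RN x y / r ^ 2) (tau RN x y / r ^ 2) (corr RN x y / r) := by
  have hr2 : 0 < r ^ 2 := by positivity
  obtain ⟨hl, hl'⟩ := sigmal_eq hRN hex
  have hHpos := sigmah_pos hp hu hRN (hxy ▸ hr2) hex
  have err : ∀ {t d : ℝ}, 0 < d → NoOverflow p emax t ∧ NoUnderflow p emin emax t →
      |RN t / d - t / d| ≤ unitRoundoff p * |t / d| := fun hd ht =>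
    rel_error_div hd (rounding_rel_error hp hRN ht)
  unfold NoException borgesExact fast2MultExact fast2SumExact at hex
  simp only [List.cons_append, List.nil_append, List.forall_mem_cons] at hex
  obtain ⟨hX, hXl, hY, hYl, hH, -, -, hq, hδ, h1, h2, h3, hc, -⟩ := hex
  refine ⟨unitRoundoff_pos p, div_nonneg (mul_self_nonneg _) hr2.le,
    div_nonneg (mul_self_nonneg _) hr2.le, ?_, err hr2 hX,
    err hr2 hY, ?_, ?_, ?_, ?_, by positivity, ?_, err hr hq, ?_, ?_, ?_, ?_, ?_⟩
  · rw [← add_div, opX_sq_add_opY_sq, hxy, div_self hr2.ne']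
  · rw [← sub_div]; exact err hr2 hXl
  · rw [← sub_div]; exact err hr2 hYl
  · rw [← add_div]; exact err hr2 hH
  · rw [← add_div, ← sub_div, hl]; exact err hr2 hl'
  · rw [div_pow, Real.sq_sqrt hHpos.le]
  · rw [div_pow, ← sub_div]; exact err hr2 hδ
  · rw [← add_div]; exact err hr2 h1
  · rw [← add_div]; exact err hr2 h2
  · rw [← add_div]; exact err hr2 h3
  -- With division by zero equal to zero, the identity needs no proof that `s` is nonzero.
  · rw [show tau RN x y / r ^ 2 / (sqrtApprox RN x y / r) = tau RN x y / sqrtApprox RN x y / r by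
      by_cases hs : sqrtApprox RN x y = 0
      · simp [hs]
      · field_simp]
    exact err hr hc

/-- Combination of the error before the final rounding and of the final rounding error. -/
lemma relError_le {ρ t r v E : ℝ} (hr : 0 < r) (hv : 0 ≤ v) (hF : |ρ - t| ≤ v * |t|)
    (hE : |t / r - 1| ≤ E) : relError ρ r ≤ v * (1 + E) + E := by
  unfold relError
  have h1 : |t / r| ≤ 1 + E := by
    have := abs_sub_abs_le_abs_sub (t / r) 1
    rw [abs_one] at this
    linarith
  have h2 : |ρ / r - t / r| ≤ v * (1 + E) := by
    refine (rel_error_div hr hF).trans ?_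
    gcongr
  rw [show (ρ - r) / r = (ρ / r - t / r) + (t / r - 1) by field_simp; ring]
  exact (abs_add_le _ _).trans (add_le_add h2 hE)

lemma borgesFused_relError_le (hp : 4 ≤ p) (hRN : IsRoundToNearest p emin emax RN)
    (hxy : x ≠ 0 ∨ y ≠ 0) (hex : NoException p emin emax RN x y) :
    relError (borgesFused RN x y) (√(x ^ 2 + y ^ 2)) ≤
      unitRoundoff p + (7 + (100 * unitRoundoff p + 3000 * unitRoundoff p ^ 2 - 0.02)) *
        unitRoundoff p ^ 2 := by
  have hu0 := unitRoundoff_pos p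
  have hu16 : unitRoundoff p ≤ 1 / 16 := by
    unfold unitRoundoff
    calc (2 : ℝ) ^ (-(p : ℤ)) ≤ 2 ^ (-4 : ℤ) := zpow_le_zpow_right₀ one_le_two (by omega)
      _ = 1 / 16 := by norm_num
  have hpos : 0 < x ^ 2 + y ^ 2 := by
    rcases hxy with h | h <;> positivity
  set r := √(x ^ 2 + y ^ 2)
  have hr : 0 < r := Real.sqrt_pos.2 hpos
  have hr2 : x ^ 2 + y ^ 2 = r ^ 2 := (Real.sq_sqrt hpos.le).symm
  have hp1 : 1 ≤ p := by omega
  have run := scaledRun_of_noException hp1 (by linarith) hRN hr hr2 hex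
  have hHpos := sigmah_pos hp1 (by linarith) hRN hpos hex
  have hlast : NoOverflow p emax (corr RN x y / 2 + sqrtApprox RN x y) ∧
      NoUnderflow p emin emax (corr RN x y / 2 + sqrtApprox RN x y) :=
    hex _ (by simp [borgesExact])
  have hq : NoOverflow p emax (√(sigmah RN x y)) ∧ NoUnderflow p emin emax (√(sigmah RN x y)) :=
    hex _ (by simp [borgesExact])
  have hF := rounding_rel_error hp1 hRN hlast
  have hsplit : (corr RN x y / 2 + sqrtApprox RN x y) / r - 1 =
      corr RN x y / r / 2 + sqrtApprox RN x y / r - 1 := by ring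
  have hgen := run.abs_sub_one_le_general hu16
  rw [← hsplit] at hgen
  rcases le_or_gt p 5 with hp5 | hp5
  · refine (relError_le hr hu0.le hF hgen).trans ?_
    obtain rfl | rfl : p = 4 ∨ p = 5 := by omega
    all_goals norm_num [unitRoundoff, zpow_neg]
  have hu64 : unitRoundoff p ≤ 1 / 64 := by
    unfold unitRoundoff
    calc (2 : ℝ) ^ (-(p : ℤ)) ≤ 2 ^ (-6 : ℤ) := zpow_le_zpow_right₀ one_le_two (by omega)
      _ = 1 / 64 := by norm_num
  rcases le_or_gt |corr RN x y| (11 / 5 * unitRoundoff p * sqrtApprox RN x y) with hc | hc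
  · have hsmall := run.abs_sub_one_le_of_small hu64 (by
      rw [abs_div, abs_of_pos hr, mul_div_assoc']
      gcongr)
    rw [← hsplit] at hsmall
    refine (relError_le hr hu0.le hF hsmall).trans ?_
    set u := unitRoundoff p
    have key : (6.81 + 60 * u) * (1 + u) ≤ 7 + (100 * u + 3000 * u ^ 2 - 0.02) := by nlinarith
    nlinarith [mul_le_mul_of_nonneg_left key (sq_nonneg u)]
  · have hF' := rounding_corrected_error hp1 hRN hu64 (Real.sqrt_pos.2 hHpos) hq hlast hc (by
      intro w hw
      have h1 := run.abs_corr_le hu64 (w := w / r) (by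
        rw [← sub_div, abs_div, abs_of_pos hr]
        gcongr
        exact hw)
      rw [abs_div, abs_of_pos hr] at h1
      refine le_of_mul_le_mul_right (a := 1 / r) ?_ (by positivity)
      calc _ = |corr RN x y| / r / 2 := by ring
        _ ≤ _ := h1
        _ = (1.09 * w + 1.15 * (unitRoundoff p * sqrtApprox RN x y)) * (1 / r) := by ring)
    change |borgesFused RN x y - (corr RN x y / 2 + sqrtApprox RN x y)| ≤
      0.9 * (unitRoundoff p * (corr RN x y / 2 + sqrtApprox RN x y)) at hF'
    set u := unitRoundoff p
    set t := corr RN x y / 2 + sqrtApprox RN x y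
    have hF'' : |borgesFused RN x y - t| ≤ 0.9 * u * |t| := by
      rw [mul_assoc]
      refine hF'.trans ?_
      gcongr
      exact le_abs_self t
    refine (relError_le hr (by positivity) hF'' hgen).trans ?_
    -- The `0.1` is the part of `u` saved by the final rounding.
    have key : u * ((10 + 60 * u) * (1 + 0.9 * u)) ≤
        0.1 + u * (7 + (100 * u + 3000 * u ^ 2 - 0.02)) := by nlinarith [pow_pos hu0 3]
    nlinarith [mul_le_mul_of_nonneg_left key hu0.le]

end Assembly

end HypotFP

theorem mainTheorem5 (p : ℕ) (hp : 4 ≤ p) (u : ℝ) (hu : u = HypotFP.unitRoundoff p) :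
    ∃ κ : ℝ,
      (u ≤ (2 : ℝ) ^ (-4 : ℤ) → κ ≤ 21.4) ∧
      (u ≤ (2 : ℝ) ^ (-5 : ℤ) → κ ≤ 6.1) ∧
      (u ≤ (2 : ℝ) ^ (-6 : ℤ) → κ ≤ 2.5) ∧
      (u ≤ (2 : ℝ) ^ (-7 : ℤ) → κ ≤ 1.2) ∧
      (u ≤ (2 : ℝ) ^ (-8 : ℤ) → κ ≤ 0.6) ∧
      (u ≤ (2 : ℝ) ^ (-11 : ℤ) → κ ≤ 7 * (10 : ℝ) ^ (-2 : ℤ)) ∧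
      (u ≤ (2 : ℝ) ^ (-24 : ℤ) → κ ≤ 8 * (10 : ℝ) ^ (-6 : ℤ)) ∧
      (u ≤ (2 : ℝ) ^ (-53 : ℤ) → κ ≤ 2 * (10 : ℝ) ^ (-14 : ℤ)) ∧
      (u ≤ (2 : ℝ) ^ (-113 : ℤ) → κ ≤ 2 * (10 : ℝ) ^ (-32 : ℤ)) ∧
      ∀ (emin emax : ℤ) (RN : ℝ → ℝ), HypotFP.IsRoundToNearest p emin emax RN →
        ∀ x y : ℝ, HypotFP.IsFP p emin emax x → HypotFP.IsFP p emin emax y →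
          (x ≠ 0 ∨ y ≠ 0) →
          HypotFP.NoException p emin emax RN x y →
          HypotFP.relError (HypotFP.borgesFused RN x y) (√(x ^ 2 + y ^ 2))
            ≤ u + (7 + κ) * u ^ 2 := by
  subst hu
  have hu0 := HypotFP.unitRoundoff_pos p
  have bound : ∀ {b K : ℝ}, 100 * b + 3000 * b ^ 2 - 0.02 ≤ K → HypotFP.unitRoundoff p ≤ b →
      100 * HypotFP.unitRoundoff p + 3000 * HypotFP.unitRoundoff p ^ 2 - 0.02 ≤ K := by
    intro b K hK hb
    refine le_trans ?_ hK
    gcongr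
  -- This `κ` increases with `u`, so each line is checked at its threshold. The quadratic term
  -- serves `p = 4, 5`; the `-0.02` is room left by `6.81 < 7`.
  refine ⟨100 * HypotFP.unitRoundoff p + 3000 * HypotFP.unitRoundoff p ^ 2 - 0.02,
    bound (by norm_num), bound (by norm_num), bound (by norm_num), bound (by norm_num),
    bound (by norm_num), bound (by norm_num), bound (by norm_num), bound (by norm_num),
    bound (by norm_num), ?_⟩
  intro emin emax RN hRN x y _ _ hxy hex
  exact HypotFP.borgesFused_relError_le hp hRN hxy hex
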